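/- **Theorem (the folded Wasserstein metric space).** Let $(X,\|\cdot\|)$ be a (real) Banach space, let $C\subset X$ be a nonempty norm-compact convex set, and let $E$ be the set of extreme points of $C$; assume that $E$ is compact (hence Polish) for the norm topology, called the natural topology. Let $d$ be a distance on $E$ that induces the natural topology on $E$ and satisfies $$d(x,y)\ \ge\ \|x-y\|\qquad\text{for all }x,y\in E .$$ For $x\in C$ let $\mathcal P_x$ be the set of Radon (equivalently, Borel) probability measures $\mu$ on $E$ that represent $x$, i.e. $\int_E f\,\mathrm d\mu=f(x)$ for every continuous linear functional $f\in X^*$. Let $p\in[1,\infty)$. For probability measures $\mu,\nu$ on $E$ let $$W_p(\mu,\nu)=\Bigl(\inf_{\pi}\iint_{E\times E}d(x,y)^p\,\mathrm d\pi(x,y)\Bigr)^{1/p},$$ the infimum being over all couplings $\pi$ of $\mu$ and $\nu$ (probability measures on $E\times E$ with marginals $\mu$ and $\nu$). For $x,y\in C$ let $$\widehat D_p(x,y)=\inf_{\mu\in\mathcal P_x}\ \inf_{\nu\in\mathcal P_y}W_p(\mu,\nu),$$ $$D_p(x,y)=\inf\Bigl\{\sum_{n=1}^{N}\widehat D_p(z_n,z_{n+1})\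 :\ N\ge1,\ z_1,\dots,z_{N+1}\in C,\ z_1=x,\ z_{N+1}=y\Bigr\}.$$ Then: (i) $D_p$ is a (finite) distance on $C$, and the metric space $(C,D_p)$ is compact. If moreover the relative interior $$\mathrm{Ri}(C)=\{x\in C:\ \exists\,\varepsilon>0,\ \mathrm{Aff}(C)\cap B_\varepsilon(x)\subset C\}$$ is nonempty (where $\mathrm{Aff}(C)$ is the affine hull of $C$ and $B_\varepsilon(x)$ the open norm ball), then $D_p$ induces the natural topology on $C$. (ii) If $(E,d)$ is geodesic and $p>1$, then $(C,D_p)$ is geodesic. Here a metric space $(M,\rho)$ is called geodesic if for all $x,y\in M$ there is $\gamma:[0,1]\to M$ with $\gamma(0)=x$, $\gamma(1)=y$ and $\rho(\gamma(s),\gamma(t))=|s-t|\,\rho(x,y)$ for all $s,t\in[0,1]$. (iii) $D_p(x,y)\ge\|x-y\|$ for all $x,y\in C$. (iv) $D_p(x,y)\le d(x,y)$ for all $x,y\in E$. If moreover $d(x,y)=\|x-y\|$ for all $x,y\in E$, then $D_p(x,y)=d(x,y)$ for all $x,y\in E$. -/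

import Mathlib

open MeasureTheory
open scoped ENNReal

noncomputable section

namespace FoldedOT

/-- `d` is a distance on `α`. -/
structure IsDistance {α : Type*} (d : α → α → ℝ) : Prop where
  nonneg : ∀ x y, 0 ≤ d x y
  eq_zero_iff : ∀ x y, d x y = 0 ↔ x = y
  symm : ∀ x y, d x y = d y x
  triangle : ∀ x y z, d x z ≤ d x y + d y z

/-- The topology induced by a distance: `s` is open iff it contains a `d`-ball of positive radius
around each of its points. -/
abbrev distTopology {α : Type*} (d : α → α → ℝ) : TopologicalSpace α where
  IsOpen s := ∀ x ∈ s, ∃ ε > 0, ∀ y, d x y < ε → y ∈ s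
  isOpen_univ := fun _ _ => ⟨1, one_pos, fun _ _ => trivial⟩
  isOpen_inter := by
    intro s t hs ht x hx
    obtain ⟨ε, hε, h⟩ := hs x hx.1
    obtain ⟨δ, hδ, h'⟩ := ht x hx.2
    exact ⟨min ε δ, lt_min hε hδ, fun y hy =>
      ⟨h y (lt_of_lt_of_le hy (min_le_left _ _)), h' y (lt_of_lt_of_le hy (min_le_right _ _))⟩⟩
  isOpen_sUnion := by
    intro S hS x hx
    obtain ⟨s, hs, hxs⟩ := hx
    obtain ⟨ε, hε, h⟩ := hS s hs x hxs
    exact ⟨ε, hε, fun y hy => ⟨s, hs, h y hy⟩⟩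

/-- `(α, d)` is geodesic: any two points are joined by a constant-speed minimizing curve. -/
def IsGeodesic {α : Type*} (d : α → α → ℝ) : Prop :=
  ∀ x y, ∃ γ : Set.Icc (0 : ℝ) 1 → α, γ 0 = x ∧ γ 1 = y ∧
    ∀ s t, d (γ s) (γ t) = |(s : ℝ) - (t : ℝ)| * d x y

/-- The set of couplings of `μ` and `ν`. -/
def couplings {E₁ E₂ : Type*} [MeasurableSpace E₁] [MeasurableSpace E₂]
    (μ : ProbabilityMeasure E₁) (ν : ProbabilityMeasure E₂) :
    Set (ProbabilityMeasure (E₁ × E₂)) :=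
  {π | (π : Measure (E₁ × E₂)).map Prod.fst = (μ : Measure E₁) ∧
       (π : Measure (E₁ × E₂)).map Prod.snd = (ν : Measure E₂)}

/-- The Kantorovich cost associated with the cost function `c`. -/
def kantorovichCost {E₁ E₂ : Type*} [MeasurableSpace E₁] [MeasurableSpace E₂]
    (c : E₁ → E₂ → ℝ≥0∞) (μ : ProbabilityMeasure E₁) (ν : ProbabilityMeasure E₂) : ℝ≥0∞ :=
  ⨅ π ∈ couplings μ ν, ∫⁻ z, c z.1 z.2 ∂(π : Measure (E₁ × E₂))

/-- The Wasserstein-`p` distance associated with `d`. -/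
def wasserstein {E : Type*} [MeasurableSpace E] (d : E → E → ℝ) (p : ℝ)
    (μ ν : ProbabilityMeasure E) : ℝ≥0∞ :=
  (kantorovichCost (fun x y => ENNReal.ofReal (d x y) ^ p) μ ν) ^ (1 / p)

section Folded

variable {X : Type*} [NormedAddCommGroup X] [NormedSpace ℝ X] [MeasurableSpace X]

/-- The probability measures on the extreme boundary of `C` that represent `x`. The extreme
boundary carries the (trace) Borel σ-algebra; when it is compact and metrizable every Borel
probability measure on it is Radon. -/
def representing (C : Set X) (x : X) : Set (ProbabilityMeasure (C.extremePoints ℝ)) :=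
  {μ | ∀ f : X →L[ℝ] ℝ,
    ∫ y : C.extremePoints ℝ, f (y : X) ∂(μ : Measure (C.extremePoints ℝ)) = f x}

variable {C : Set X}

/-- The folded Kantorovich semi-distance `D̂_p` on `C`. -/
def foldedKantorovich (d : C.extremePoints ℝ → C.extremePoints ℝ → ℝ) (p : ℝ) (x y : C) : ℝ≥0∞ :=
  ⨅ μ ∈ representing C (x : X), ⨅ ν ∈ representing C (y : X), wasserstein d p μ ν

/-- The folded Wasserstein pseudo-distance `D_p` on `C`, with values in `[0, ∞]`: the infimum of
the `D̂_p`-length over all finite chains `x = z 0, z 1, …, z N = y` of points of `C`. -/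
def foldedWasserstein (d : C.extremePoints ℝ → C.extremePoints ℝ → ℝ) (p : ℝ) (x y : C) : ℝ≥0∞ :=
  ⨅ (N : ℕ) (z : ℕ → C) (_ : 1 ≤ N ∧ z 0 = x ∧ z N = y),
    ∑ n ∈ Finset.range N, foldedKantorovich d p (z n) (z (n + 1))

/-- `D_p` as a real-valued function. -/
def foldedDist (d : C.extremePoints ℝ → C.extremePoints ℝ → ℝ) (p : ℝ) (x y : C) : ℝ :=
  (foldedWasserstein d p x y).toReal

/-- An extreme point of `C`, seen as a point of `C`. -/
def ofExtreme (x : C.extremePoints ℝ) : C := ⟨x, extremePoints_subset x.2⟩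

end Folded

end FoldedOT

end

namespace FoldedOT

open Filter Topology
open scoped NNReal

/-! ### Distances, their topology, and a criterion for geodesicity. -/

section Distance

variable {α : Type*} {d : α → α → ℝ}

/-! Everything is read off measures on the compact space E. Every point of C is the barycenter of
some measure on E (`representing_nonempty`, from Krein–Milman and weak compactness), and every
measure on E has a barycenter in C. Since D_p is an infimum over chains, its triangle inequality is
automatic, and the triangle inequality of W_p (gluing of couplings) is never needed. The workhorse
is `le_add_foldedWasserstein`: a function on C that grows by at most D̂_p along each step grows by
at most D_p.

Testing a coupling against a norming functional and comparing the L¹ and L^p norms gives ‖x - y‖ ≤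
W_p(μ, ν), hence ‖x - y‖ ≤ D_p(x, y). This separates points and gives (iii); the reverse bound on E
comes from Dirac masses.

Compactness: the barycenter map from measures to C is onto, and it is continuous into (C, D_p),
because weakly close measures are joined by three short Wasserstein steps through discretizations
(`eventually_exists_chain`). The D_p-topology is therefore compact; being finer than the Hausdorff
norm topology, it equals it.

Geodesics: moving mass along a near-optimal coupling to measurably chosen approximate intermediate
points, then taking the barycenter, splits a D̂_p-step in any proportion; Minkowski controls the
error. Chains inherit this property, and `IsDistance.isGeodesic_of_approx` passes to the limit by
compactness. -/

theorem IsDistance.self_eq_zero (hd : IsDistance d) (x : α) : d x x = 0 :=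
  (hd.eq_zero_iff x x).2 rfl

theorem IsDistance.abs_sub_le (hd : IsDistance d) (x y x' y' : α) :
    |d x' y' - d x y| ≤ d x x' + d y y' := by
  have h1 := hd.triangle x' x y'
  have h2 := hd.triangle x y y'
  have h3 := hd.triangle x x' y
  have h4 := hd.triangle x' y' y
  rw [hd.symm x' x] at h1
  rw [hd.symm y' y] at h4
  rw [_root_.abs_sub_le_iff]
  constructor <;> linarith

theorem IsDistance.isOpen_ball (hd : IsDistance d) (x : α) (ε : ℝ) :
    IsOpen[distTopology d] {y | d x y < ε} := by
  intro y hy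
  refine ⟨ε - d x y, sub_pos.2 hy, fun z hz => ?_⟩
  have := hd.triangle x y z
  simp only [Set.mem_ofPred_eq]
  linarith

theorem IsDistance.eventually_lt [t : TopologicalSpace α] (hd : IsDistance d)
    (ht : distTopology d = t) (x : α) {ε : ℝ} (hε : 0 < ε) : ∀ᶠ y in 𝓝 x, d x y < ε := by
  have h : IsOpen {y | d x y < ε} := by
    have := hd.isOpen_ball x ε
    rwa [ht] at this
  exact h.mem_nhds (by simpa [hd.self_eq_zero] using hε)

theorem IsDistance.continuous [t : TopologicalSpace α] (hd : IsDistance d)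
    (ht : distTopology d = t) : Continuous fun z : α × α => d z.1 z.2 := by
  rw [continuous_iff_continuousAt]
  rintro ⟨x, y⟩
  rw [ContinuousAt, Metric.tendsto_nhds]
  intro ε hε
  have h1 := (hd.eventually_lt ht x (half_pos hε)).prod_nhds (hd.eventually_lt ht y (half_pos hε))
  filter_upwards [h1] with z hz
  rw [Real.dist_eq]
  exact (hd.abs_sub_le x y z.1 z.2).trans_lt (by linarith [hz.1, hz.2])

/-- A compact topology finer than a Hausdorff one coincides with it. -/
theorem eq_of_le_of_compactSpace {t t' : TopologicalSpace α} (ht : @CompactSpace α t)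
    (ht' : @T2Space α t') (hle : t ≤ t') : t = t' := by
  refine le_antisymm hle ?_
  rw [← continuous_id_iff_le] at hle ⊢
  have hc := @Continuous.isClosedMap α α t t' ht ht' id hle
  refine @continuous_iff_isClosed α α t' t id |>.2 fun s hs => ?_
  simpa using hc s hs

theorem IsDistance.exists_subdivision
    (hmid : ∀ x y L, d x y < L → ∀ a ∈ Set.Ioo (0 : ℝ) 1,
      ∃ z, d x z < a * L ∧ d z y < (1 - a) * L) (N : ℕ) :
    ∀ x y L, d x y < L → ∃ w : ℕ → α, w 0 = x ∧ w (N + 1) = y ∧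
      ∀ k ≤ N, d (w k) (w (k + 1)) ≤ L / (N + 1) := by
  induction N with
  | zero =>
    intro x y L h
    refine ⟨fun n => if n = 0 then x else y, by simp, by simp, fun k hk => ?_⟩
    obtain rfl : k = 0 := by omega
    simpa using h.le
  | succ N ih =>
    intro x y L h
    have hN : (0 : ℝ) < N + 1 := by positivity
    have hN2 : (0 : ℝ) < N + 2 := by positivity
    -- Cutting off the fraction 1/(N+2) leaves (N+1)/(N+2) of L for N+1 steps, so all steps share
    -- the bound L/(N+2).
    obtain ⟨z, hxz, hzy⟩ := hmid x y L h (1 / (N + 2))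
      ⟨by positivity, by rw [div_lt_one hN2]; linarith⟩
    obtain ⟨w, hw0, hwN, hw⟩ := ih z y _ hzy
    refine ⟨fun n => if n = 0 then x else w (n - 1), by simp, by simp [hwN], fun k hk => ?_⟩
    rcases k with _ | k
    · simp only [↓reduceIte, zero_add, one_ne_zero, tsub_self, hw0]
      refine hxz.le.trans (le_of_eq ?_)
      push_cast
      field_simp
      ring
    · have := hw k (by omega)
      simp only [Nat.add_eq_zero_iff, one_ne_zero, and_false, ↓reduceIte, Nat.add_sub_cancel]
      refine this.trans (le_of_eq ?_)
      push_cast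
      field_simp
      ring

theorem IsDistance.le_mul_of_step_le (hd : IsDistance d) {w : ℕ → α} {N : ℕ} {δ : ℝ}
    (hw : ∀ k < N, d (w k) (w (k + 1)) ≤ δ) (i j : ℕ) (hij : i ≤ j) (hj : j ≤ N) :
    d (w i) (w j) ≤ ((j : ℝ) - i) * δ := by
  induction j, hij using Nat.le_induction with
  | base => simp [hd.self_eq_zero]
  | succ j hij ih =>
    have h1 := hd.triangle (w i) (w j) (w (j + 1))
    have h2 := hw j (by omega)
    have h3 := ih (by omega)
    push_cast
    linarith

/-- A compact metric space in which any two points have approximate intermediate points is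
geodesic. -/
theorem IsDistance.isGeodesic_of_approx [t : TopologicalSpace α] [CompactSpace α]
    (hd : IsDistance d) (ht : distTopology d = t)
    (hmid : ∀ x y L, d x y < L → ∀ a ∈ Set.Ioo (0 : ℝ) 1,
      ∃ z, d x z < a * L ∧ d z y < (1 - a) * L) : IsGeodesic d := by
  intro x y
  have hsub : ∀ n : ℕ, ∃ w : ℕ → α, w 0 = x ∧ w (n + 1) = y ∧
      ∀ k ≤ n, d (w k) (w (k + 1)) ≤ (d x y + 1 / ((n : ℝ) + 1)) / (n + 1) := fun n =>
    IsDistance.exists_subdivision hmid n x y _ (by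
      have : (0 : ℝ) < 1 / ((n : ℝ) + 1) := by positivity
      linarith)
  choose w hw0 hw1 hw using hsub
  -- Step curve through the subdivision into n+1 pieces. Rounding costs at most one extra piece,
  -- whence the 1/(n+1) in the bound below.
  let c : ℕ → Set.Icc (0 : ℝ) 1 → α := fun n s => w n ⌊(s : ℝ) * (n + 1)⌋₊
  have hc : ∀ n (s r : Set.Icc (0 : ℝ) 1), s ≤ r →
      d (c n s) (c n r) ≤ ((r : ℝ) - s + 1 / ((n : ℝ) + 1)) * (d x y + 1 / ((n : ℝ) + 1)) := by
    intro n s r hsr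
    have hn : (0 : ℝ) < n + 1 := by positivity
    have hsr' : (s : ℝ) ≤ r := hsr
    have hfl : ⌊(r : ℝ) * (n + 1)⌋₊ ≤ n + 1 := by
      refine Nat.floor_le_of_le ?_
      push_cast
      nlinarith [r.2.2]
    have h1 := hd.le_mul_of_step_le (w := w n) (N := n + 1) (fun k hk => hw n k (by omega))
      ⌊(s : ℝ) * (n + 1)⌋₊ ⌊(r : ℝ) * (n + 1)⌋₊ (Nat.floor_mono (by nlinarith)) hfl
    refine h1.trans ?_
    have h2 : (⌊(r : ℝ) * (n + 1)⌋₊ : ℝ) ≤ r * (n + 1) :=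
      Nat.floor_le (mul_nonneg r.2.1 hn.le)
    have h3 := Nat.lt_floor_add_one ((s : ℝ) * (n + 1))
    have h4 : 0 ≤ d x y + 1 / ((n : ℝ) + 1) := add_nonneg (hd.nonneg _ _) (by positivity)
    rw [← mul_div_assoc, mul_comm, mul_div_assoc, mul_comm]
    gcongr
    rw [div_le_iff₀ hn]
    have : ((r : ℝ) - s + 1 / ((n : ℝ) + 1)) * (n + 1) = r * (n + 1) - s * (n + 1) + 1 := by
      field_simp
    linarith
  -- A single ultrafilter gives limits for all parameters at once, so no diagonal extraction or
  -- equicontinuity is needed.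
  have hlim : ∀ s, ∃ z, Tendsto (fun n => c n s) (hyperfilter ℕ : Filter ℕ) (𝓝 z) := fun s => by
    obtain ⟨z, -, hz⟩ := isCompact_univ.ultrafilter_le_nhds
      ((hyperfilter ℕ).map fun n => c n s) (by simp)
    exact ⟨z, hz⟩
  choose γ hγ using hlim
  have hγ0 : d x (γ 0) = 0 := by
    refine tendsto_nhds_unique (((hd.continuous ht).tendsto (x, γ 0)).comp
      (tendsto_const_nhds.prodMk_nhds (hγ 0))) ?_
    simp [c, Function.comp_def, hw0, hd.self_eq_zero]
  have hγ1 : d y (γ 1) = 0 := by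
    refine tendsto_nhds_unique (((hd.continuous ht).tendsto (y, γ 1)).comp
      (tendsto_const_nhds.prodMk_nhds (hγ 1))) ?_
    have : ∀ n, c n 1 = y := fun n => by
      have : ⌊((n : ℝ) + 1)⌋₊ = n + 1 := by exact_mod_cast Nat.floor_natCast (R := ℝ) (n + 1)
      simp [c, this, hw1]
    simp [Function.comp_def, this, hd.self_eq_zero]
  rw [hd.eq_zero_iff] at hγ0 hγ1
  have hle : ∀ s r, s ≤ r → d (γ s) (γ r) ≤ ((r : ℝ) - s) * d x y := by
    intro s r hsr
    have h1 := ((hd.continuous ht).tendsto (γ s, γ r)).comp ((hγ s).prodMk_nhds (hγ r))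
    have h0 : Tendsto (fun n : ℕ => 1 / ((n : ℝ) + 1)) (hyperfilter ℕ : Filter ℕ) (𝓝 0) :=
      tendsto_one_div_add_atTop_nhds_zero_nat.mono_left
        (Nat.cofinite_eq_atTop ▸ hyperfilter_le_cofinite)
    have h2 : Tendsto (fun n : ℕ => ((r : ℝ) - s + 1 / ((n : ℝ) + 1)) *
        (d x y + 1 / ((n : ℝ) + 1))) (hyperfilter ℕ : Filter ℕ)
        (𝓝 (((r : ℝ) - s + 0) * (d x y + 0))) := (h0.const_add _).mul (h0.const_add _)
    simpa using le_of_tendsto_of_tendsto' h1 h2 fun n => hc n s r hsr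
  -- The upper bounds on the three pieces from x to γ s, γ r and y add up to d x y, so the triangle
  -- inequality forces equality in each.
  have heq : ∀ s r, s ≤ r → d (γ s) (γ r) = ((r : ℝ) - s) * d x y := by
    intro s r hsr
    refine le_antisymm (hle s r hsr) ?_
    have h1 := hle 0 s s.2.1
    have h2 := hle r 1 r.2.2
    have h3 := hd.triangle x (γ s) y
    have h4 := hd.triangle (γ s) (γ r) y
    rw [← hγ0] at h1
    rw [← hγ1] at h2
    simp only [Set.Icc.coe_zero, Set.Icc.coe_one] at h1 h2
    linarith
  refine ⟨γ, hγ0.symm, hγ1.symm, fun s r => ?_⟩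
  rcases le_total s r with h | h
  · rw [heq s r h, abs_sub_comm, abs_of_nonneg (sub_nonneg.2 (show (s : ℝ) ≤ r from h))]
  · rw [hd.symm, heq r s h, abs_of_nonneg (sub_nonneg.2 (show (r : ℝ) ≤ s from h))]

end Distance

theorem rpow_one_div_lt_iff {p : ℝ} (hp : 0 < p) {a b : ℝ≥0∞} : a ^ (1 / p) < b ↔ a < b ^ p := by
  rw [one_div, ENNReal.rpow_inv_lt_iff hp]

theorem rpow_one_div_le_iff {p : ℝ} (hp : 0 < p) {a b : ℝ≥0∞} : a ^ (1 / p) ≤ b ↔ a ≤ b ^ p := by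
  rw [one_div, ENNReal.rpow_inv_le_iff hp]

/-! ### Partitions of unity and boundedness on a compact space. -/

section Compact

variable {E : Type*} [TopologicalSpace E] [CompactSpace E] {d : E → E → ℝ}

/-- A partition of unity subordinate to small balls. -/
theorem exists_partition_small [T2Space E] (hd : IsDistance d)
    (hc : Continuous fun z : E × E => d z.1 z.2)
    {ε : ℝ} (hε : 0 < ε) :
    ∃ (n : ℕ) (e : Fin n → E) (φ : Fin n → C(E, ℝ≥0)),
      (∀ x, ∑ i, φ i x = 1) ∧ ∀ i x, φ i x ≠ 0 → d x (e i) < ε := by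
  have hopen : ∀ y : E, IsOpen {x | d x y < ε} := fun y =>
    isOpen_lt (hc.comp (by fun_prop : Continuous fun x : E => (x, y))) continuous_const
  obtain ⟨t, ht⟩ := isCompact_univ.elim_finite_subcover (fun y : E => {x | d x y < ε}) hopen
    fun x _ => Set.mem_iUnion.2 ⟨x, by simpa [hd.self_eq_zero] using hε⟩
  let e : Fin t.card → E := fun i => (t.equivFin.symm i : E)
  obtain ⟨f, hsub, hsum, hIcc, -⟩ := exists_continuous_sum_one_of_isOpen_isCompact
    (s := fun i => {x | d x (e i) < ε}) (fun i => hopen (e i)) (isCompact_univ (X := E)) (by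
      intro x hx
      obtain ⟨y, hy, hxy⟩ := Set.mem_iUnion₂.1 (ht hx)
      exact Set.mem_iUnion.2 ⟨t.equivFin ⟨y, hy⟩, by simpa [e] using hxy⟩)
  refine ⟨t.card, e, fun i => ⟨fun x => ⟨f i x, (hIcc i x).1⟩, by fun_prop⟩, fun x => ?_,
    fun i x hx => ?_⟩
  · apply NNReal.coe_injective
    have := hsum (Set.mem_univ x)
    simp only [Finset.sum_apply, Pi.one_apply] at this
    push_cast
    exact this
  · refine hsub i (subset_tsupport _ ?_)
    rw [Function.mem_support]
    intro h
    exact hx (NNReal.coe_injective h)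

theorem exists_ofReal_le (hc : Continuous fun z : E × E => d z.1 z.2) :
    ∃ K : ℝ≥0, ∀ x y, ENNReal.ofReal (d x y) ≤ K := by
  obtain ⟨K, hK⟩ := isCompact_univ.bddAbove_image hc.continuousOn
  exact ⟨K.toNNReal, fun x y => ENNReal.ofReal_le_ofReal (hK ⟨(x, y), trivial, rfl⟩)⟩

end Compact

/-! ### Estimates of W_p by explicit couplings. -/

section Wasserstein

variable {E : Type*} [MeasurableSpace E] {d : E → E → ℝ} {p : ℝ}

theorem wasserstein_le_of_mem_couplings (hp : 0 ≤ p) {μ ν : ProbabilityMeasure E}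
    {π : ProbabilityMeasure (E × E)} (hπ : π ∈ couplings μ ν) :
    wasserstein d p μ ν ≤
      (∫⁻ z, ENNReal.ofReal (d z.1 z.2) ^ p ∂(π : Measure (E × E))) ^ (1 / p) :=
  ENNReal.rpow_le_rpow (iInf₂_le π hπ) (by positivity)

theorem exists_coupling_lt_of_wasserstein_lt (hp : 0 < p) {μ ν : ProbabilityMeasure E}
    {L : ℝ≥0∞} (h : wasserstein d p μ ν < L) :
    ∃ π ∈ couplings μ ν,
      (∫⁻ z, ENNReal.ofReal (d z.1 z.2) ^ p ∂(π : Measure (E × E))) ^ (1 / p) < L := by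
  have h' : kantorovichCost (fun x y => ENNReal.ofReal (d x y) ^ p) μ ν < L ^ p := by
    rw [wasserstein, rpow_one_div_lt_iff hp] at h
    exact h
  obtain ⟨π, hπ, hlt⟩ := (by simpa [kantorovichCost, iInf_lt_iff] using h' :
    ∃ π ∈ couplings μ ν, ∫⁻ z, ENNReal.ofReal (d z.1 z.2) ^ p ∂(π : Measure (E × E)) < L ^ p)
  exact ⟨π, hπ, (rpow_one_div_lt_iff hp).2 hlt⟩

theorem wasserstein_comm_le (hp : 0 < p) (hsymm : ∀ x y, d x y = d y x)
    (hm : Measurable fun z : E × E => d z.1 z.2)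
    (μ ν : ProbabilityMeasure E) : wasserstein d p ν μ ≤ wasserstein d p μ ν := by
  refine le_of_forall_gt fun L hL => ?_
  obtain ⟨π, hπ, hlt⟩ := exists_coupling_lt_of_wasserstein_lt hp hL
  refine lt_of_le_of_lt ?_ hlt
  have hs : π.map (measurable_swap.aemeasurable) ∈ couplings ν μ := by
    constructor
    · rw [ProbabilityMeasure.toMeasure_map, Measure.map_map measurable_fst measurable_swap]
      exact hπ.2
    · rw [ProbabilityMeasure.toMeasure_map, Measure.map_map measurable_snd measurable_swap]
      exact hπ.1
  refine (wasserstein_le_of_mem_couplings hp.le hs).trans (le_of_eq ?_)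
  rw [ProbabilityMeasure.toMeasure_map, lintegral_map (by fun_prop) measurable_swap]
  simp_rw [Prod.fst_swap, Prod.snd_swap, hsymm]

/-- The image of a probability measure under two maps gives a coupling of the images. -/
theorem wasserstein_map_map_le {Ω : Type*} [MeasurableSpace Ω] (hp : 0 ≤ p)
    (hm : Measurable fun z : E × E => d z.1 z.2) (π : ProbabilityMeasure Ω)
    {f g : Ω → E} (hf : Measurable f) (hg : Measurable g) :
    wasserstein d p (π.map hf.aemeasurable) (π.map hg.aemeasurable) ≤
      (∫⁻ z, ENNReal.ofReal (d (f z) (g z)) ^ p ∂(π : Measure Ω)) ^ (1 / p) := by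
  have hs : π.map (hf.prodMk hg).aemeasurable ∈
      couplings (π.map hf.aemeasurable) (π.map hg.aemeasurable) := by
    constructor
    · simp only [ProbabilityMeasure.toMeasure_map]
      rw [Measure.map_map measurable_fst (hf.prodMk hg)]
      rfl
    · simp only [ProbabilityMeasure.toMeasure_map]
      rw [Measure.map_map measurable_snd (hf.prodMk hg)]
      rfl
  refine (wasserstein_le_of_mem_couplings hp hs).trans (le_of_eq ?_)
  rw [ProbabilityMeasure.toMeasure_map, lintegral_map (by fun_prop) (hf.prodMk hg)]

/-- Two probability measures with a large common part are close in the Wasserstein distance. -/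
theorem wasserstein_le_of_eq_add (hp : 0 < p) (h0 : ∀ x, d x x = 0) {K : ℝ≥0∞}
    (hK : ∀ x y, ENNReal.ofReal (d x y) ≤ K) (hm : Measurable fun z : E × E => d z.1 z.2)
    {μ ν : ProbabilityMeasure E} {κ α β : Measure E}
    (hμ : (μ : Measure E) = κ + α) (hν : (ν : Measure E) = κ + β) :
    wasserstein d p μ ν ≤ (K ^ p * α Set.univ) ^ (1 / p) := by
  have hμ1 : κ Set.univ + α Set.univ = 1 := by
    rw [← Measure.add_apply, ← hμ]; exact measure_univ
  have hν1 : κ Set.univ + β Set.univ = 1 := by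
    rw [← Measure.add_apply, ← hν]; exact measure_univ
  have hκ : κ Set.univ ≠ ⊤ := fun h => by simp [h] at hμ1
  have hα : α Set.univ ≠ ⊤ := fun h => by simp [h] at hμ1
  have hαβ : α Set.univ = β Set.univ := (ENNReal.add_right_inj hκ).1 (hμ1.trans hν1.symm)
  have : IsFiniteMeasure α := ⟨hα.lt_top⟩
  have : IsFiniteMeasure β := ⟨hαβ ▸ hα.lt_top⟩
  -- The common part stays put on the diagonal, at no cost; the remainders are coupled by their
  -- normalized product.
  let π : Measure (E × E) := κ.map (fun x => (x, x)) + (α Set.univ)⁻¹ • α.prod β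
  have hdiag : Measurable fun x : E => (x, x) := by fun_prop
  have hfst : π.map Prod.fst = μ := by
    rw [Measure.map_add _ _ measurable_fst, Measure.map_map measurable_fst hdiag,
      Measure.map_smul, Measure.map_fst_prod, ← hαβ, hμ]
    congr 1
    · exact Measure.map_id
    · rcases eq_or_ne (α Set.univ) 0 with h | h
      · rw [Measure.measure_univ_eq_zero.1 h]; simp
      · rw [smul_smul, ENNReal.inv_mul_cancel h hα, one_smul]
  have hsnd : π.map Prod.snd = ν := by
    rw [Measure.map_add _ _ measurable_snd, Measure.map_map measurable_snd hdiag,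
      Measure.map_smul, Measure.map_snd_prod, hν]
    congr 1
    · exact Measure.map_id
    · rcases eq_or_ne (α Set.univ) 0 with h | h
      · rw [show β = 0 from Measure.measure_univ_eq_zero.1 (hαβ.symm.trans h)]; simp
      · rw [smul_smul, ENNReal.inv_mul_cancel h hα, one_smul]
  have : IsProbabilityMeasure π := ⟨by
    have : π.map Prod.fst Set.univ = 1 := by rw [hfst]; exact measure_univ
    rwa [Measure.map_apply measurable_fst MeasurableSet.univ, Set.preimage_univ] at this⟩
  refine (wasserstein_le_of_mem_couplings (π := ⟨π, this⟩) hp.le ⟨hfst, hsnd⟩).trans ?_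
  refine ENNReal.rpow_le_rpow ?_ (by positivity)
  have hmeas : Measurable fun z : E × E => ENNReal.ofReal (d z.1 z.2) ^ p := by fun_prop
  change ∫⁻ z, ENNReal.ofReal (d z.1 z.2) ^ p ∂π ≤ _
  rw [lintegral_add_measure, lintegral_map hmeas hdiag, lintegral_smul_measure]
  simp only [h0, ENNReal.ofReal_zero, ENNReal.zero_rpow_of_pos hp, lintegral_zero, zero_add,
    smul_eq_mul]
  calc (α Set.univ)⁻¹ * ∫⁻ z, ENNReal.ofReal (d z.1 z.2) ^ p ∂α.prod β
      ≤ (α Set.univ)⁻¹ * ∫⁻ _, K ^ p ∂α.prod β := by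
        gcongr with z
        exact hK _ _
    _ = (α Set.univ)⁻¹ * α Set.univ * (K ^ p * α Set.univ) := by
        rw [lintegral_const, ← Set.univ_prod_univ, Measure.prod_prod, ← hαβ]; ring
    _ ≤ K ^ p * α Set.univ := mul_le_of_le_one_left' (ENNReal.inv_mul_le_one _)

/-! ### Discretization, weak convergence, and measurable intermediate points. -/

variable [TopologicalSpace E] [BorelSpace E]

theorem sum_lintegral_eq_one {n : ℕ} {φ : Fin n → C(E, ℝ≥0)} (hφ : ∀ x, ∑ i, φ i x = 1)
    (μ : ProbabilityMeasure E) : ∑ i, ∫⁻ x, φ i x ∂(μ : Measure E) = 1 := by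
  rw [← lintegral_finsetSum _ fun i _ => by fun_prop]
  have : ∀ x, ∑ i, (φ i x : ℝ≥0∞) = 1 := fun x => by exact_mod_cast hφ x
  simp [this]

/-- The finitely supported measure obtained by moving the mass of `φ i • μ` to the point `e i`. -/
noncomputable def discretize {n : ℕ} (e : Fin n → E) {φ : Fin n → C(E, ℝ≥0)}
    (hφ : ∀ x, ∑ i, φ i x = 1) (μ : ProbabilityMeasure E) : ProbabilityMeasure E :=
  ⟨∑ i, (∫⁻ x, φ i x ∂(μ : Measure E)) • Measure.dirac (e i),
    ⟨by simpa using sum_lintegral_eq_one hφ μ⟩⟩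

theorem wasserstein_discretize_le (hp : 0 < p) (hm : Measurable fun z : E × E => d z.1 z.2)
    {n : ℕ} (e : Fin n → E) {φ : Fin n → C(E, ℝ≥0)} (hφ : ∀ x, ∑ i, φ i x = 1) {ε : ℝ}
    (hε : ∀ i x, φ i x ≠ 0 → d x (e i) < ε) (μ : ProbabilityMeasure E) :
    wasserstein d p μ (discretize e hφ μ) ≤ ENNReal.ofReal ε := by
  let m : Fin n → Measure E := fun i => (μ : Measure E).withDensity fun x => φ i x
  have hmeas : ∀ i, Measurable fun x => (φ i x : ℝ≥0∞) := fun i => by fun_prop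
  have hpair : ∀ i, Measurable fun x : E => (x, e i) := fun i => by fun_prop
  -- The mass φ i x at x is sent to e i, which lies within ε of x whenever that mass is nonzero.
  let π : Measure (E × E) := ∑ i, (m i).map fun x => (x, e i)
  have hmap : ∀ {β : Type _} [MeasurableSpace β] {f : E × E → β}, Measurable f →
      π.map f = ∑ i, (m i).map fun x => f (x, e i) := by
    intro β _ f hf
    ext s hs
    simp only [π, Measure.map_apply hf hs, Measure.finsetSum_apply,
      Measure.map_apply (hpair _) (hf hs)]
    refine Finset.sum_congr rfl fun i _ => ?_
    exact (Measure.map_apply (hf.comp (hpair i)) hs).symm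
  have hfst : π.map Prod.fst = μ := by
    rw [hmap measurable_fst]
    ext s hs
    simp only [Measure.finsetSum_apply, m, Measure.map_id', withDensity_apply _ hs]
    rw [← lintegral_finsetSum _ fun i _ => hmeas i]
    have : ∀ x, ∑ i, (φ i x : ℝ≥0∞) = 1 := fun x => by exact_mod_cast hφ x
    simp [this]
  have hsnd : π.map Prod.snd = discretize e hφ μ := by
    rw [hmap measurable_snd]
    simp [discretize, m, Measure.map_const]
  have : IsProbabilityMeasure π := ⟨by
    have : π.map Prod.fst Set.univ = 1 := by rw [hfst]; exact measure_univ
    rwa [Measure.map_apply measurable_fst MeasurableSet.univ, Set.preimage_univ] at this⟩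
  refine (wasserstein_le_of_mem_couplings (π := ⟨π, this⟩) hp.le ⟨hfst, hsnd⟩).trans ?_
  rw [rpow_one_div_le_iff hp]
  change ∫⁻ z, ENNReal.ofReal (d z.1 z.2) ^ p ∂π ≤ _
  have hcost : Measurable fun z : E × E => ENNReal.ofReal (d z.1 z.2) ^ p := by fun_prop
  rw [lintegral_finsetSum_measure]
  calc ∑ i, ∫⁻ z, ENNReal.ofReal (d z.1 z.2) ^ p ∂(m i).map (fun x => (x, e i))
      = ∑ i, ∫⁻ x, φ i x * ENNReal.ofReal (d x (e i)) ^ p ∂(μ : Measure E) := by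
        refine Finset.sum_congr rfl fun i _ => ?_
        rw [lintegral_map hcost (hpair i)]
        exact lintegral_withDensity_eq_lintegral_mul _ (hmeas i) (hcost.comp (hpair i))
    _ ≤ ∑ i, ∫⁻ x, φ i x * ENNReal.ofReal ε ^ p ∂(μ : Measure E) := by
        refine Finset.sum_le_sum fun i _ => lintegral_mono fun x => ?_
        by_cases h : φ i x = 0
        · simp [h]
        · have := (hε i x h).le
          gcongr
    _ = ENNReal.ofReal ε ^ p := by
        simp_rw [fun i => lintegral_mul_const (ENNReal.ofReal ε ^ p) (μ := (μ : Measure E))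
          (hmeas i)]
        rw [← Finset.sum_mul, sum_lintegral_eq_one hφ, one_mul]

/-- Both measures live on the same atoms, so they share the minimum of their weights, and only the
excess (a truncated difference) has to move. -/
theorem wasserstein_discretize_discretize_le (hp : 0 < p) (h0 : ∀ x, d x x = 0) {K : ℝ≥0∞}
    (hK : ∀ x y, ENNReal.ofReal (d x y) ≤ K) (hm : Measurable fun z : E × E => d z.1 z.2)
    {n : ℕ} (e : Fin n → E) {φ : Fin n → C(E, ℝ≥0)} (hφ : ∀ x, ∑ i, φ i x = 1)
    (μ ν : ProbabilityMeasure E) :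
    wasserstein d p (discretize e hφ μ) (discretize e hφ ν) ≤
      (K ^ p * ∑ i, (∫⁻ x, φ i x ∂(μ : Measure E) - ∫⁻ x, φ i x ∂(ν : Measure E))) ^ (1 / p) := by
  let a : Fin n → ℝ≥0∞ := fun i => ∫⁻ x, φ i x ∂(μ : Measure E)
  let b : Fin n → ℝ≥0∞ := fun i => ∫⁻ x, φ i x ∂(ν : Measure E)
  have h := wasserstein_le_of_eq_add (p := p) hp h0 hK hm (μ := discretize e hφ μ)
    (ν := discretize e hφ ν) (κ := ∑ i, min (a i) (b i) • Measure.dirac (e i))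
    (α := ∑ i, (a i - b i) • Measure.dirac (e i)) (β := ∑ i, (b i - a i) • Measure.dirac (e i))
    (by
      simp only [discretize, ProbabilityMeasure.coe_mk, ← Finset.sum_add_distrib, ← add_smul]
      refine Finset.sum_congr rfl fun i _ => ?_
      congr 1
      rcases le_total (a i) (b i) with h | h
      · rw [min_eq_left h, tsub_eq_zero_of_le h, add_zero]
      · rw [min_eq_right h, add_tsub_cancel_of_le h])
    (by
      simp only [discretize, ProbabilityMeasure.coe_mk, ← Finset.sum_add_distrib, ← add_smul]
      refine Finset.sum_congr rfl fun i _ => ?_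
      congr 1
      rcases le_total (a i) (b i) with h | h
      · rw [min_eq_left h, add_tsub_cancel_of_le h]
      · rw [min_eq_right h, tsub_eq_zero_of_le h, add_zero])
  simpa [a, b] using h

/-- Weakly close measures are linked by a short chain of small Wasserstein steps. -/
theorem eventually_exists_chain [CompactSpace E] [T2Space E] [SecondCountableTopology E]
    (hp : 0 < p) (hd : IsDistance d)
    (hc : Continuous fun z : E × E => d z.1 z.2) (μ : ProbabilityMeasure E) {ε : ℝ}
    (hε : 0 < ε) :
    ∀ᶠ ν in 𝓝 μ, ∃ μ' ν' : ProbabilityMeasure E, wasserstein d p μ μ' ≤ ENNReal.ofReal ε ∧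
      wasserstein d p μ' ν' ≤ ENNReal.ofReal ε ∧ wasserstein d p ν ν' ≤ ENNReal.ofReal ε := by
  obtain ⟨n, e, φ, hφ, hsmall⟩ := exists_partition_small hd hc hε
  obtain ⟨K, hK⟩ := exists_ofReal_le hc
  have hfin : ∀ (ν : ProbabilityMeasure E) i, ∫⁻ x, φ i x ∂(ν : Measure E) ≠ ⊤ := fun ν i =>
    ne_top_of_le_ne_top ENNReal.one_ne_top ((Finset.single_le_sum (fun _ _ => zero_le)
      (Finset.mem_univ i)).trans (sum_lintegral_eq_one hφ ν).le)
  have hlim : Tendsto (fun ν : ProbabilityMeasure E => ((K : ℝ≥0∞) ^ p *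
      ∑ i, (∫⁻ x, φ i x ∂(μ : Measure E) - ∫⁻ x, φ i x ∂(ν : Measure E))) ^ (1 / p))
      (𝓝 μ) (𝓝 (((K : ℝ≥0∞) ^ p * ∑ i : Fin n, 0) ^ (1 / p))) := by
    refine Tendsto.ennrpow_const _ (ENNReal.Tendsto.const_mul ?_
      (Or.inr (ENNReal.rpow_ne_top_of_nonneg hp.le ENNReal.coe_ne_top)))
    refine tendsto_finsetSum _ fun i _ => ?_
    rw [← tsub_self (∫⁻ x, φ i x ∂(μ : Measure E))]
    exact ENNReal.Tendsto.sub tendsto_const_nhds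
      ((ProbabilityMeasure.continuous_lintegral_continuousMap (φ i)).tendsto μ)
      (Or.inl (hfin μ i))
  have h0 : ((K : ℝ≥0∞) ^ p * ∑ i : Fin n, (0 : ℝ≥0∞)) ^ (1 / p) < ENNReal.ofReal ε := by
    simpa [hp] using hε
  filter_upwards [hlim.eventually_lt_const h0] with ν hν
  -- The outer steps are small for every measure; only the middle one uses weak closeness, through
  -- the finitely many integrals of φ i.
  exact ⟨discretize e hφ μ, discretize e hφ ν,
    wasserstein_discretize_le hp hc.measurable e hφ hsmall μ,
    (wasserstein_discretize_discretize_le hp hd.self_eq_zero hK hc.measurable e hφ μ ν).trans hν.le,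
    wasserstein_discretize_le hp hc.measurable e hφ hsmall ν⟩

/-- Measurable approximate intermediate points in a geodesic space. -/
theorem IsGeodesic.exists_measurable_approx [SecondCountableTopology E] (hg : IsGeodesic d)
    (hc : Continuous fun z : E × E => d z.1 z.2) {a ε : ℝ} (ha : a ∈ Set.Icc (0 : ℝ) 1)
    (hε : 0 < ε) :
    ∃ M : E × E → E, Measurable M ∧
      ∀ z, d z.1 (M z) ≤ a * d z.1 z.2 + ε ∧ d (M z) z.2 ≤ (1 - a) * d z.1 z.2 + ε := by
  rcases isEmpty_or_nonempty E with hE | hE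
  · exact ⟨Prod.fst, measurable_fst, fun z => hE.elim z.1⟩
  classical
  let u := TopologicalSpace.denseSeq E
  let Q : E × E → ℕ → Prop := fun z n =>
    d z.1 (u n) < a * d z.1 z.2 + ε ∧ d (u n) z.2 < (1 - a) * d z.1 z.2 + ε
  have hex : ∀ z, ∃ n, Q z n := by
    rintro ⟨x, y⟩
    obtain ⟨γ, h0, h1, hγ⟩ := hg x y
    have hopen : IsOpen {w | d x w < a * d x y + ε ∧ d w y < (1 - a) * d x y + ε} :=
      (isOpen_lt (hc.comp (by fun_prop : Continuous fun w : E => (x, w))) continuous_const).inter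
        (isOpen_lt (hc.comp (by fun_prop : Continuous fun w : E => (w, y))) continuous_const)
    obtain ⟨n, hw⟩ := (TopologicalSpace.denseRange_denseSeq E).exists_mem_open hopen
      ⟨γ ⟨a, ha⟩, by
        have e1 := hγ 0 ⟨a, ha⟩
        have e2 := hγ ⟨a, ha⟩ 1
        rw [h0] at e1
        rw [h1] at e2
        simp only [Set.Icc.coe_zero, Set.Icc.coe_one, zero_sub, abs_neg, abs_of_nonneg ha.1,
          abs_sub_comm a 1, abs_of_nonneg (sub_nonneg.2 ha.2)] at e1 e2
        simp only [Set.mem_ofPred_eq, e1, e2]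
        constructor <;> linarith⟩
    exact ⟨n, hw⟩
  have hmeas : ∀ n, MeasurableSet {z | Q z n} := fun n =>
    ((isOpen_lt (hc.comp (by fun_prop : Continuous fun z : E × E => (z.1, u n)))
      (by fun_prop)).inter
    (isOpen_lt (hc.comp (by fun_prop : Continuous fun z : E × E => (u n, z.2)))
      (by fun_prop))).measurableSet
  -- Choosing the least admissible index in a dense sequence is measurable; the slack ε is what
  -- allows a dense sequence to replace exact geodesic points.
  exact ⟨fun z => u (Nat.find (hex z)), measurable_from_nat.comp (measurable_find hex hmeas),
    fun z => ⟨(Nat.find_spec (hex z)).1.le, (Nat.find_spec (hex z)).2.le⟩⟩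

end Wasserstein

theorem wasserstein_le_bound {E : Type*} [MeasurableSpace E] {d : E → E → ℝ} {p : ℝ}
    (hp : 0 < p) (h0 : ∀ x, d x x = 0) {K : ℝ≥0∞}
    (hK : ∀ x y, ENNReal.ofReal (d x y) ≤ K) (hm : Measurable fun z : E × E => d z.1 z.2)
    (μ ν : ProbabilityMeasure E) : wasserstein d p μ ν ≤ K := by
  refine (wasserstein_le_of_eq_add hp h0 hK hm (κ := 0) (α := μ) (β := ν) (by simp)
    (by simp)).trans ?_
  rw [measure_univ, mul_one, rpow_one_div_le_iff hp]

theorem wasserstein_self {E : Type*} [MeasurableSpace E] {d : E → E → ℝ} {p : ℝ}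
    (hp : 0 < p) (h0 : ∀ x, d x x = 0) (hm : Measurable fun z : E × E => d z.1 z.2)
    (μ : ProbabilityMeasure E) : wasserstein d p μ μ = 0 := by
  -- No bound on d is needed: no mass moves, and ⊤ * 0 = 0.
  refine le_antisymm ((wasserstein_le_of_eq_add hp h0 (K := ⊤) (fun _ _ => le_top) hm (κ := μ)
    (α := 0) (β := 0) (by simp) (by simp)).trans ?_) zero_le
  simp [hp]

theorem wasserstein_dirac_le {E : Type*} [MeasurableSpace E] {d : E → E → ℝ} {p : ℝ}
    (hp : 0 < p) (hm : Measurable fun z : E × E => d z.1 z.2) (x y : E) :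
    wasserstein d p (diracProba x) (diracProba y) ≤ ENNReal.ofReal (d x y) := by
  have h : diracProba (x, y) ∈ couplings (diracProba x) (diracProba y) :=
    ⟨Measure.map_dirac' measurable_fst _, Measure.map_dirac' measurable_snd _⟩
  refine (wasserstein_le_of_mem_couplings hp.le h).trans ?_
  rw [rpow_one_div_le_iff hp]
  change ∫⁻ z, ENNReal.ofReal (d z.1 z.2) ^ p ∂(Measure.dirac (x, y)) ≤ _
  rw [lintegral_dirac' _ (by fun_prop)]

/-! ### Representing measures and barycenters. -/

section Representing

variable {X : Type*} [NormedAddCommGroup X] [NormedSpace ℝ X] [MeasurableSpace X] [BorelSpace X]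
  {C : Set X}

theorem diracProba_mem_representing (x : C.extremePoints ℝ) :
    diracProba x ∈ representing C (x : X) := fun f => by
  change ∫ y : C.extremePoints ℝ, f (y : X) ∂(Measure.dirac x) = f x
  rw [integral_dirac' _ _ (by fun_prop : Measurable _).stronglyMeasurable]

variable [CompactSpace (C.extremePoints ℝ)]

theorem integrable_extremePoints {F : Type*} [NormedAddCommGroup F] (f : X → F)
    (hf : Continuous f) (μ : Measure (C.extremePoints ℝ)) [IsFiniteMeasure μ] :
    Integrable (fun y : C.extremePoints ℝ => f y) μ :=
  (hf.comp continuous_subtype_val).integrable_of_hasCompactSupport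
    (HasCompactSupport.of_compactSpace _)

theorem exists_mem_representing_of_probabilityMeasure [CompleteSpace X] (hCc : IsCompact C)
    (hCx : Convex ℝ C) (μ : ProbabilityMeasure (C.extremePoints ℝ)) :
    ∃ x : C, μ ∈ representing C (x : X) :=
  ⟨⟨∫ y : C.extremePoints ℝ, (y : X) ∂(μ : Measure (C.extremePoints ℝ)),
    hCx.integral_mem hCc.isClosed (ae_of_all _ fun y => extremePoints_subset y.2)
      (integrable_extremePoints id continuous_id _)⟩,
    fun f => f.integral_comp_comm (integrable_extremePoints id continuous_id _)⟩

theorem convex_setOf_representing : Convex ℝ {x : X | (representing C x).Nonempty} := by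
  rintro x ⟨μ, hμ⟩ y ⟨ν, hν⟩ a b ha hb hab
  let ρ : Measure (C.extremePoints ℝ) :=
    ENNReal.ofReal a • (μ : Measure _) + ENNReal.ofReal b • (ν : Measure _)
  have hρ : IsProbabilityMeasure ρ := ⟨by
    simp [ρ, ← ENNReal.ofReal_add ha hb, hab]⟩
  refine ⟨⟨ρ, hρ⟩, fun f => ?_⟩
  change ∫ y : C.extremePoints ℝ, f (y : X) ∂ρ = _
  rw [integral_add_measure
    ((integrable_extremePoints f f.continuous _).smul_measure ENNReal.ofReal_ne_top)
    ((integrable_extremePoints f f.continuous _).smul_measure ENNReal.ofReal_ne_top),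
    integral_smul_measure, integral_smul_measure, hμ f, hν f, ENNReal.toReal_ofReal ha,
    ENNReal.toReal_ofReal hb]
  simp

/-- Measures representing approximating points have a weak limit by compactness, and the
representation identity passes to that limit because functionals are continuous on E. -/
theorem isClosed_setOf_representing : IsClosed {x : X | (representing C x).Nonempty} := by
  refine isClosed_of_closure_subset fun x hx => ?_
  rcases Set.eq_empty_or_nonempty {x : X | (representing C x).Nonempty} with h | ⟨x₀, μ₀, -⟩
  · simp [h] at hx
  obtain ⟨u, hu, hux⟩ := mem_closure_iff_ultrafilter.1 hx
  -- The default `μ₀` only makes the choice total; the ultrafilter ignores points without a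
  -- representing measure.
  have hex : ∀ y, ∃ μ, y ∈ {x : X | (representing C x).Nonempty} → μ ∈ representing C y := by
    intro y
    by_cases hy : (representing C y).Nonempty
    · exact ⟨hy.some, fun _ => hy.some_mem⟩
    · exact ⟨μ₀, fun h => (hy h).elim⟩
  choose m hm using hex
  obtain ⟨μ, -, hμ⟩ := isCompact_univ.ultrafilter_le_nhds (u.map m) (by simp)
  refine ⟨μ, fun f => ?_⟩
  let g : C(C.extremePoints ℝ, ℝ) := ⟨fun y => f y, by fun_prop⟩
  have h1 : Tendsto (fun y => ∫ e : C.extremePoints ℝ, f (e : X) ∂(m y : Measure _)) u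
      (𝓝 (∫ e : C.extremePoints ℝ, f (e : X) ∂(μ : Measure _))) :=
    ((ProbabilityMeasure.continuous_integral_continuousMap g).tendsto μ).comp hμ
  have h2 : Tendsto (fun y => f y) u (𝓝 (f x)) := (f.continuous.tendsto x).mono_left hux
  refine tendsto_nhds_unique h1 (h2.congr' ?_)
  filter_upwards [hu] with y hy
  exact (hm y hy f).symm

/-- Every point of `C` is the barycenter of a measure on the extreme boundary. -/
theorem representing_nonempty (hCc : IsCompact C) (hCx : Convex ℝ C) (x : C) :
    (representing C (x : X)).Nonempty := by
  have hx : (x : X) ∈ closure (convexHull ℝ (C.extremePoints ℝ)) :=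
    (closure_convexHull_extremePoints hCc hCx).symm ▸ x.2
  refine closure_minimal (convexHull_min (fun y hy => ?_) convex_setOf_representing)
    isClosed_setOf_representing hx
  exact ⟨_, diracProba_mem_representing ⟨y, hy⟩⟩

variable [SecondCountableTopology (C.extremePoints ℝ)]

/-- A norming functional of x - y is 1-Lipschitz for d, so its integral against any coupling is at
most the L¹ cost, which on a probability space is at most the L^p cost. -/
theorem enorm_sub_le_wasserstein {d : C.extremePoints ℝ → C.extremePoints ℝ → ℝ} {p : ℝ}
    (hc : Continuous fun z : C.extremePoints ℝ × C.extremePoints ℝ => d z.1 z.2)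
    (hnorm : ∀ x y : C.extremePoints ℝ, ‖(x : X) - (y : X)‖ ≤ d x y) (hp : 1 ≤ p) {x y : X}
    {μ ν : ProbabilityMeasure (C.extremePoints ℝ)} (hμ : μ ∈ representing C x)
    (hν : ν ∈ representing C y) : ‖x - y‖ₑ ≤ wasserstein d p μ ν := by
  refine le_of_forall_gt fun L hL => ?_
  obtain ⟨π, hπ, hlt⟩ := exists_coupling_lt_of_wasserstein_lt (by linarith) hL
  refine lt_of_le_of_lt ?_ hlt
  obtain ⟨f, hf1, hf⟩ := exists_dual_vector'' ℝ (x - y)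
  have hxy : ‖x - y‖ₑ = ‖∫ z, (f (z.1 : X) - f (z.2 : X))
      ∂(π : Measure (C.extremePoints ℝ × C.extremePoints ℝ))‖ₑ := by
    have i1 := integrable_extremePoints f f.continuous (μ : Measure (C.extremePoints ℝ))
    have i2 := integrable_extremePoints f f.continuous (ν : Measure (C.extremePoints ℝ))
    rw [← hπ.1] at i1
    rw [← hπ.2] at i2
    have e1 := hμ f
    have e2 := hν f
    rw [← hπ.1, integral_map measurable_fst.aemeasurable i1.1] at e1
    rw [← hπ.2, integral_map measurable_snd.aemeasurable i2.1] at e2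
    have e3 := integral_sub (i1.comp_measurable measurable_fst)
      (i2.comp_measurable measurable_snd)
    simp only [Function.comp_apply] at e3
    rw [e3, e1, e2, ← map_sub, hf]
    simp
  have hd0 : ∀ x y, 0 ≤ d x y := fun x y => (norm_nonneg _).trans (hnorm x y)
  calc ‖x - y‖ₑ ≤ ∫⁻ z, ‖f (z.1 : X) - f (z.2 : X)‖ₑ
        ∂(π : Measure (C.extremePoints ℝ × C.extremePoints ℝ)) :=
        hxy ▸ enorm_integral_le_lintegral_enorm _
    _ ≤ ∫⁻ z, ‖d z.1 z.2‖ₑ ∂(π : Measure (C.extremePoints ℝ × C.extremePoints ℝ)) := by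
        refine lintegral_mono fun z => ?_
        rw [enorm_le_iff_norm_le, ← map_sub, Real.norm_of_nonneg (hd0 _ _)]
        exact (f.le_opNorm _).trans ((mul_le_of_le_one_left (norm_nonneg _) hf1).trans (hnorm _ _))
    _ = eLpNorm' (fun z => d z.1 z.2) 1 (π : Measure (C.extremePoints ℝ × C.extremePoints ℝ)) := by
        simp [eLpNorm']
    _ ≤ eLpNorm' (fun z => d z.1 z.2) p (π : Measure (C.extremePoints ℝ × C.extremePoints ℝ)) :=
        eLpNorm'_le_eLpNorm'_of_exponent_le one_pos hp _ hc.aestronglyMeasurable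
    _ = _ := by simp [eLpNorm', Real.enorm_of_nonneg (hd0 _ _)]

end Representing

/-! ### Chains and the elementary calculus of D_p. -/

section Folded

variable {X : Type*} [NormedAddCommGroup X] [NormedSpace ℝ X] [MeasurableSpace X] {C : Set X}
  {d : C.extremePoints ℝ → C.extremePoints ℝ → ℝ} {p : ℝ}

theorem foldedKantorovich_le_wasserstein {x y : C} {μ ν : ProbabilityMeasure (C.extremePoints ℝ)}
    (hμ : μ ∈ representing C (x : X)) (hν : ν ∈ representing C (y : X)) :
    foldedKantorovich d p x y ≤ wasserstein d p μ ν :=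
  (iInf₂_le μ hμ).trans (iInf₂_le ν hν)

theorem foldedWasserstein_le_foldedKantorovich (x y : C) :
    foldedWasserstein d p x y ≤ foldedKantorovich d p x y := by
  refine (iInf_le _ 1).trans ((iInf_le _ fun n => if n = 0 then x else y).trans
    ((iInf_le _ ⟨le_rfl, by simp, by simp⟩).trans ?_))
  simp

theorem foldedWasserstein_le_wasserstein {x y : C} {μ ν : ProbabilityMeasure (C.extremePoints ℝ)}
    (hμ : μ ∈ representing C (x : X)) (hν : ν ∈ representing C (y : X)) :
    foldedWasserstein d p x y ≤ wasserstein d p μ ν :=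
  (foldedWasserstein_le_foldedKantorovich x y).trans (foldedKantorovich_le_wasserstein hμ hν)

/-- Telescoping along a chain. It serves with F a D_p-distance to or from a fixed point (symmetry,
triangle inequality) and with F a norm distance (lower bound). -/
theorem le_add_foldedWasserstein {F : C → ℝ≥0∞}
    (hF : ∀ y z, F z ≤ F y + foldedKantorovich d p y z) (y z : C) :
    F z ≤ F y + foldedWasserstein d p y z := by
  simp only [foldedWasserstein, ENNReal.add_iInf]
  refine le_iInf fun N => le_iInf fun w => le_iInf fun h => ?_
  have hk : ∀ k, F (w k) ≤ F (w 0) +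
      ∑ n ∈ Finset.range k, foldedKantorovich d p (w n) (w (n + 1)) := by
    intro k
    induction k with
    | zero => simp
    | succ k ih =>
      rw [Finset.sum_range_succ, ← add_assoc]
      exact (hF _ _).trans (add_le_add_left ih _)
  simpa [h.2.1, h.2.2] using hk N

theorem foldedWasserstein_le_add_foldedKantorovich (x y z : C) :
    foldedWasserstein d p x z ≤ foldedWasserstein d p x y + foldedKantorovich d p y z := by
  conv_rhs => simp only [foldedWasserstein, ENNReal.iInf_add]
  refine le_iInf fun N => le_iInf fun w => le_iInf fun h => ?_
  refine (iInf_le _ (N + 1)).trans ((iInf_le _ fun n => if n ≤ N then w n else z).trans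
    ((iInf_le _ ⟨by omega, by simp [h.2.1], by simp⟩).trans (le_of_eq ?_)))
  rw [Finset.sum_range_succ]
  congr 1
  · refine Finset.sum_congr rfl fun n hn => ?_
    have hn' := Finset.mem_range.1 hn
    simp only [if_pos hn'.le, if_pos (Nat.succ_le_of_lt hn')]
  · simp [h.2.2]

theorem foldedWasserstein_triangle (x y z : C) :
    foldedWasserstein d p x z ≤ foldedWasserstein d p x y + foldedWasserstein d p y z :=
  le_add_foldedWasserstein (foldedWasserstein_le_add_foldedKantorovich x) y z

theorem exists_wasserstein_lt_of_foldedKantorovich_lt {x y : C} {L : ℝ≥0∞}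
    (h : foldedKantorovich d p x y < L) :
    ∃ μ ∈ representing C (x : X), ∃ ν ∈ representing C (y : X), wasserstein d p μ ν < L := by
  simpa [foldedKantorovich, iInf_lt_iff] using h

theorem foldedKantorovich_comm_le (hp : 0 < p) (hd : IsDistance d)
    (hm : Measurable fun z : C.extremePoints ℝ × C.extremePoints ℝ => d z.1 z.2) (x y : C) :
    foldedKantorovich d p y x ≤ foldedKantorovich d p x y := by
  refine le_of_forall_gt fun L hL => ?_
  obtain ⟨μ, hμ, ν, hν, h⟩ := exists_wasserstein_lt_of_foldedKantorovich_lt hL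
  exact ((foldedKantorovich_le_wasserstein hν hμ).trans
    (wasserstein_comm_le hp hd.symm hm μ ν)).trans_lt h

/-- Intermediate points exist along any concatenation of steps that have them. -/
theorem exists_intermediate_trans {x y z : C} {L₁ L₂ : ℝ≥0∞}
    (h₁ : ∀ a b : ℝ≥0∞, a ≠ ⊤ → b ≠ ⊤ → L₁ < a + b →
      ∃ w, foldedWasserstein d p x w ≤ a ∧ foldedWasserstein d p w y ≤ b)
    (h₂ : ∀ a b : ℝ≥0∞, a ≠ ⊤ → b ≠ ⊤ → L₂ < a + b →
      ∃ w, foldedWasserstein d p y w ≤ a ∧ foldedWasserstein d p w z ≤ b)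
    {a b : ℝ≥0∞} (ha : a ≠ ⊤) (hb : b ≠ ⊤) (h : L₁ + L₂ < a + b) :
    ∃ w, foldedWasserstein d p x w ≤ a ∧ foldedWasserstein d p w z ≤ b := by
  -- The cut c > L₁ leaves a + b - c > L₂, so each leg has slack; comparing a with c tells on which
  -- leg the intermediate point lies.
  obtain ⟨c, hc₁, hc₂⟩ := exists_between (lt_tsub_iff_right.2 h)
  have hab : a + b ≠ ⊤ := ENNReal.add_ne_top.2 ⟨ha, hb⟩
  have hcab : c ≤ a + b := hc₂.le.trans tsub_le_self
  have hct : c ≠ ⊤ := ne_top_of_le_ne_top hab hcab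
  have hL₂ : L₂ < a + b - c := by
    rw [lt_tsub_iff_left]
    exact lt_tsub_iff_right.1 hc₂
  have het : a + b - c ≠ ⊤ := ne_top_of_le_ne_top hab tsub_le_self
  rcases le_total a c with hac | hca
  · obtain ⟨w, hw₁, hw₂⟩ := h₁ a (c - a) ha (ne_top_of_le_ne_top hct tsub_le_self)
      (by rwa [add_tsub_cancel_of_le hac])
    -- The split with first part 0 merely extracts the bound a + b - c on the whole second leg.
    obtain ⟨v, hv₁, hv₂⟩ := h₂ 0 (a + b - c) ENNReal.zero_ne_top het (by rwa [zero_add])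
    refine ⟨w, hw₁, (foldedWasserstein_triangle w y z).trans ?_⟩
    calc foldedWasserstein d p w y + foldedWasserstein d p y z
        ≤ (c - a) + (0 + (a + b - c)) :=
          add_le_add hw₂ ((foldedWasserstein_triangle y v z).trans (add_le_add hv₁ hv₂))
      _ = b := by
          rw [zero_add]
          refine (ENNReal.add_right_inj ha).1 ?_
          rw [← add_assoc, add_tsub_cancel_of_le hac, add_tsub_cancel_of_le hcab]
  · have hsplit : a + b = c + (a - c + b) := by rw [← add_assoc, add_tsub_cancel_of_le hca]
    obtain ⟨w, hw₁, hw₂⟩ := h₂ (a - c) b (ne_top_of_le_ne_top ha tsub_le_self) hb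
      (by rwa [hsplit, ENNReal.add_sub_cancel_left hct] at hL₂)
    obtain ⟨v, hv₁, hv₂⟩ := h₁ 0 c ENNReal.zero_ne_top hct (by rwa [zero_add])
    refine ⟨w, (foldedWasserstein_triangle x y w).trans ?_, hw₂⟩
    calc foldedWasserstein d p x y + foldedWasserstein d p y w
        ≤ (0 + c) + (a - c) :=
          add_le_add ((foldedWasserstein_triangle x v y).trans (add_le_add hv₁ hv₂)) hw₁
      _ = a := by rw [zero_add, add_tsub_cancel_of_le hca]

theorem foldedDist_ofExtreme_le [BorelSpace X] (hp : 0 < p) (hd : IsDistance d)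
    (hm : Measurable fun z : C.extremePoints ℝ × C.extremePoints ℝ => d z.1 z.2)
    (x y : C.extremePoints ℝ) : foldedDist d p (ofExtreme x) (ofExtreme y) ≤ d x y :=
  ENNReal.toReal_le_of_le_ofReal (hd.nonneg x y)
    ((foldedWasserstein_le_wasserstein (x := ofExtreme x) (y := ofExtreme y)
      (diracProba_mem_representing x) (diracProba_mem_representing y)).trans
      (wasserstein_dirac_le hp hm x y))

/-! ### Metric, topological and geodesic properties of D_p. -/

variable [BorelSpace X] [CompactSpace (C.extremePoints ℝ)]

theorem foldedWasserstein_self (hCc : IsCompact C) (hCx : Convex ℝ C) (hp : 0 < p)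
    (hd : IsDistance d)
    (hm : Measurable fun z : C.extremePoints ℝ × C.extremePoints ℝ => d z.1 z.2) (x : C) :
    foldedWasserstein d p x x = 0 := by
  obtain ⟨μ, hμ⟩ := representing_nonempty hCc hCx x
  exact le_antisymm ((foldedWasserstein_le_wasserstein hμ hμ).trans_eq
    (wasserstein_self hp hd.self_eq_zero hm μ)) zero_le

theorem foldedWasserstein_comm (hCc : IsCompact C) (hCx : Convex ℝ C) (hp : 0 < p)
    (hd : IsDistance d)
    (hm : Measurable fun z : C.extremePoints ℝ × C.extremePoints ℝ => d z.1 z.2) (x y : C) :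
    foldedWasserstein d p x y = foldedWasserstein d p y x := by
  have key : ∀ x y : C, foldedWasserstein d p y x ≤ foldedWasserstein d p x y := by
    intro x y
    have := le_add_foldedWasserstein (d := d) (p := p) (F := fun w => foldedWasserstein d p w x)
      (fun y z => by
        refine (foldedWasserstein_triangle z y x).trans ?_
        rw [add_comm]
        gcongr
        exact (foldedWasserstein_le_foldedKantorovich z y).trans
          (foldedKantorovich_comm_le hp hd hm y z)) x y
    simpa [foldedWasserstein_self hCc hCx hp hd hm] using this
  exact le_antisymm (key y x) (key x y)

variable [SecondCountableTopology (C.extremePoints ℝ)]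

theorem foldedWasserstein_ne_top (hCc : IsCompact C) (hCx : Convex ℝ C) (hp : 0 < p)
    (hd : IsDistance d)
    (hc : Continuous fun z : C.extremePoints ℝ × C.extremePoints ℝ => d z.1 z.2) (x y : C) :
    foldedWasserstein d p x y ≠ ⊤ := by
  obtain ⟨μ, hμ⟩ := representing_nonempty hCc hCx x
  obtain ⟨ν, hν⟩ := representing_nonempty hCc hCx y
  obtain ⟨K, hK⟩ := exists_ofReal_le hc
  exact ne_top_of_le_ne_top ENNReal.coe_ne_top ((foldedWasserstein_le_wasserstein hμ hν).trans
    (wasserstein_le_bound hp hd.self_eq_zero hK hc.measurable μ ν))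

theorem enorm_sub_le_foldedWasserstein (hp : 1 ≤ p)
    (hc : Continuous fun z : C.extremePoints ℝ × C.extremePoints ℝ => d z.1 z.2)
    (hnorm : ∀ x y : C.extremePoints ℝ, ‖(x : X) - (y : X)‖ ≤ d x y) (x y : C) :
    ‖(x : X) - (y : X)‖ₑ ≤ foldedWasserstein d p x y := by
  have := le_add_foldedWasserstein (d := d) (p := p) (F := fun w => ‖(x : X) - (w : X)‖ₑ)
    (fun y z => by
      have h : (x : X) - z = (x - y) + (y - z) := by abel
      rw [h]
      refine (enorm_add_le _ _).trans (add_le_add_right ?_ _)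
      exact le_iInf₂ fun μ hμ => le_iInf₂ fun ν hν => enorm_sub_le_wasserstein hc hnorm hp hμ hν)
    x y
  simpa using this

theorem isDistance_foldedDist (hCc : IsCompact C) (hCx : Convex ℝ C) (hp : 1 ≤ p)
    (hd : IsDistance d)
    (hc : Continuous fun z : C.extremePoints ℝ × C.extremePoints ℝ => d z.1 z.2)
    (hnorm : ∀ x y : C.extremePoints ℝ, ‖(x : X) - (y : X)‖ ≤ d x y) :
    IsDistance (foldedDist d p) := by
  have hp0 : 0 < p := by linarith
  have htop := foldedWasserstein_ne_top hCc hCx hp0 hd hc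
  refine ⟨fun _ _ => ENNReal.toReal_nonneg, fun x y => ⟨fun h => ?_, ?_⟩, fun x y => ?_,
    fun x y z => ?_⟩
  · have h0 := (ENNReal.toReal_eq_zero_iff _).1 h |>.resolve_right (htop x y)
    have := enorm_sub_le_foldedWasserstein hp hc hnorm x y
    rw [h0, nonpos_iff_eq_zero, enorm_eq_zero, sub_eq_zero] at this
    exact Subtype.ext this
  · rintro rfl
    rw [foldedDist, foldedWasserstein_self hCc hCx hp0 hd hc.measurable, ENNReal.toReal_zero]
  · rw [foldedDist, foldedDist, foldedWasserstein_comm hCc hCx hp0 hd hc.measurable]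
  · rw [foldedDist, foldedDist, foldedDist, ← ENNReal.toReal_add (htop _ _) (htop _ _)]
    exact ENNReal.toReal_mono (ENNReal.add_ne_top.2 ⟨htop _ _, htop _ _⟩)
      (foldedWasserstein_triangle x y z)

theorem norm_sub_le_foldedDist (hCc : IsCompact C) (hCx : Convex ℝ C) (hp : 1 ≤ p)
    (hd : IsDistance d)
    (hc : Continuous fun z : C.extremePoints ℝ × C.extremePoints ℝ => d z.1 z.2)
    (hnorm : ∀ x y : C.extremePoints ℝ, ‖(x : X) - (y : X)‖ ≤ d x y) (x y : C) :
    ‖(x : X) - (y : X)‖ ≤ foldedDist d p x y := by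
  rw [foldedDist, ← toReal_enorm]
  exact ENNReal.toReal_mono (foldedWasserstein_ne_top hCc hCx (by linarith) hd hc x y)
    (enorm_sub_le_foldedWasserstein hp hc hnorm x y)

/-- (C, D_p) is the continuous image, under the barycenter map, of the compact space of probability
measures on E. -/
theorem compactSpace_foldedDist [CompleteSpace X] (hCc : IsCompact C) (hCx : Convex ℝ C)
    (hp : 1 ≤ p) (hd : IsDistance d)
    (hc : Continuous fun z : C.extremePoints ℝ × C.extremePoints ℝ => d z.1 z.2) :
    @CompactSpace C (distTopology (foldedDist d p)) := by
  have hp0 : 0 < p := by linarith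
  choose b hb using exists_mem_representing_of_probabilityMeasure hCc hCx
  -- A representing measure of x has barycenter x because continuous functionals separate points.
  have hsurj : Function.Surjective b := fun x => by
    obtain ⟨μ, hμ⟩ := representing_nonempty hCc hCx x
    refine ⟨μ, Subtype.ext ((SeparatingDual.eq_iff_forall_dual_eq (R := ℝ)).2 fun f => ?_)⟩
    rw [← hb μ f, ← hμ f]
  have hcont : @Continuous _ _ _ (distTopology (foldedDist d p)) b := by
    refine @Continuous.mk _ _ _ (distTopology (foldedDist d p)) _ fun s hs => ?_
    rw [isOpen_iff_mem_nhds]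
    intro μ hμ
    obtain ⟨ε, hε, hball⟩ := hs (b μ) hμ
    -- Three steps of size ε/4 stay strictly below ε.
    filter_upwards [eventually_exists_chain hp0 hd hc μ (show 0 < ε / 4 by positivity)] with ν hν
    obtain ⟨μ', ν', h1, h2, h3⟩ := hν
    refine hball _ ?_
    have hle : foldedWasserstein d p (b μ) (b ν) ≤ ENNReal.ofReal (3 * (ε / 4)) := by
      calc foldedWasserstein d p (b μ) (b ν)
          ≤ foldedWasserstein d p (b μ) (b μ') + foldedWasserstein d p (b μ') (b ν') +
            foldedWasserstein d p (b ν') (b ν) :=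
            (foldedWasserstein_triangle _ (b ν') _).trans
              (add_le_add_left (foldedWasserstein_triangle _ _ _) _)
        _ ≤ ENNReal.ofReal (ε / 4) + ENNReal.ofReal (ε / 4) + ENNReal.ofReal (ε / 4) := by
            gcongr
            · exact (foldedWasserstein_le_wasserstein (hb _) (hb _)).trans h1
            · exact (foldedWasserstein_le_wasserstein (hb _) (hb _)).trans h2
            · rw [foldedWasserstein_comm hCc hCx hp0 hd hc.measurable]
              exact (foldedWasserstein_le_wasserstein (hb _) (hb _)).trans h3
        _ = ENNReal.ofReal (3 * (ε / 4)) := by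
            rw [← ENNReal.ofReal_add (by positivity) (by positivity),
              ← ENNReal.ofReal_add (by positivity) (by positivity)]
            congr 1
            ring
    calc foldedDist d p (b μ) (b ν) ≤ 3 * (ε / 4) :=
          ENNReal.toReal_le_of_le_ofReal (by positivity) hle
      _ < ε := by linarith
  refine @CompactSpace.mk _ (distTopology (foldedDist d p)) ?_
  rw [← hsurj.range_eq]
  exact @isCompact_range _ _ _ (distTopology (foldedDist d p)) _ _ hcont

theorem distTopology_foldedDist [CompleteSpace X] (hCc : IsCompact C) (hCx : Convex ℝ C)
    (hp : 1 ≤ p) (hd : IsDistance d)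
    (hc : Continuous fun z : C.extremePoints ℝ × C.extremePoints ℝ => d z.1 z.2)
    (hnorm : ∀ x y : C.extremePoints ℝ, ‖(x : X) - (y : X)‖ ≤ d x y) :
    distTopology (foldedDist d p) = (instTopologicalSpaceSubtype : TopologicalSpace C) := by
  refine eq_of_le_of_compactSpace (compactSpace_foldedDist hCc hCx hp hd hc) inferInstance
    fun s hs x hx => ?_
  obtain ⟨ε, hε, h⟩ := Metric.isOpen_iff.1 hs x hx
  refine ⟨ε, hε, fun y hy => h ?_⟩
  rw [Metric.mem_ball, dist_comm, Subtype.dist_eq, dist_eq_norm]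
  exact (norm_sub_le_foldedDist hCc hCx hp hd hc hnorm x y).trans_lt hy

/-- Displacement interpolation: approximate intermediate points along an optimal coupling. -/
theorem exists_intermediate_of_foldedKantorovich_lt [CompleteSpace X] (hCc : IsCompact C)
    (hCx : Convex ℝ C) (hp : 1 ≤ p) (hd : IsDistance d)
    (hc : Continuous fun z : C.extremePoints ℝ × C.extremePoints ℝ => d z.1 z.2)
    (hg : IsGeodesic d) {x y : C} {a b : ℝ≥0∞} (ha : a ≠ ⊤) (hb : b ≠ ⊤)
    (h : foldedKantorovich d p x y < a + b) :
    ∃ z, foldedWasserstein d p x z ≤ a ∧ foldedWasserstein d p z y ≤ b := by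
  have hp0 : 0 < p := by linarith
  have hself := foldedWasserstein_self (C := C) hCc hCx hp0 hd hc.measurable
  -- With a or b zero the slack ε chosen below would vanish; an endpoint then does the job.
  rcases eq_or_ne a 0 with rfl | ha0
  · exact ⟨x, (hself x).le, (foldedWasserstein_le_foldedKantorovich x y).trans
      (by simpa using h.le)⟩
  rcases eq_or_ne b 0 with rfl | hb0
  · exact ⟨y, (foldedWasserstein_le_foldedKantorovich x y).trans (by simpa using h.le),
      (hself y).le⟩
  obtain ⟨μ, hμ, ν, hν, hW⟩ := exists_wasserstein_lt_of_foldedKantorovich_lt h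
  obtain ⟨π, hπ, hlt⟩ := exists_coupling_lt_of_wasserstein_lt hp0 hW
  set L₀ := (∫⁻ z, ENNReal.ofReal (d z.1 z.2) ^ p
    ∂(π : Measure (C.extremePoints ℝ × C.extremePoints ℝ))) ^ (1 / p) with hL₀
  have hL0 : a + b ≠ 0 := by simp [ha0]
  have hLt : a + b ≠ ⊤ := ENNReal.add_ne_top.2 ⟨ha, hb⟩
  obtain ⟨T, hT⟩ : ∃ T, T = a / (a + b) := ⟨_, rfl⟩
  obtain ⟨S, hS⟩ : ∃ S, S = b / (a + b) := ⟨_, rfl⟩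
  have hTL : T * (a + b) = a := hT ▸ ENNReal.div_mul_cancel hL0 hLt
  have hSL : S * (a + b) = b := hS ▸ ENNReal.div_mul_cancel hL0 hLt
  have hTS : T + S = 1 := by
    rw [hT, hS, ENNReal.div_add_div_same, ENNReal.div_self hL0 hLt]
  have hTt : T ≠ ⊤ := fun h => by simp [h] at hTS
  have hSt : S ≠ ⊤ := fun h => by simp [h] at hTS
  have hT0 : T ≠ 0 := hT ▸ (ENNReal.div_pos ha0 hLt).ne'
  have hS0 : S ≠ 0 := hS ▸ (ENNReal.div_pos hb0 hLt).ne'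
  -- The gap between L₀ and a + b, scaled by the smaller proportion, so that the same error fits in
  -- both parts: R * L₀ + ε ≤ R * (a + b) for R = T and R = S.
  obtain ⟨ε, hε⟩ : ∃ ε, ε = min T S * (a + b - L₀) := ⟨_, rfl⟩
  have hε0 : ε ≠ 0 := by
    rw [hε]
    refine mul_ne_zero ?_ (tsub_pos_of_lt hlt).ne'
    rcases min_choice T S with h | h <;> rw [h] <;> assumption
  have hεt : ε ≠ ⊤ := by
    rw [hε]
    exact ENNReal.mul_ne_top (ne_top_of_le_ne_top hTt (min_le_left _ _))
      (ne_top_of_le_ne_top hLt tsub_le_self)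
  have hbound : ∀ R, min T S ≤ R → R * L₀ + ε ≤ R * (a + b) := by
    intro R hR
    calc R * L₀ + ε ≤ R * L₀ + R * (a + b - L₀) := by rw [hε]; gcongr
      _ = R * (a + b) := by rw [← mul_add, add_tsub_cancel_of_le hlt.le]
  have hLp : ∀ R (g : C.extremePoints ℝ × C.extremePoints ℝ → ℝ≥0∞), min T S ≤ R →
      (∀ z, g z ≤ R * ENNReal.ofReal (d z.1 z.2) + ε) →
      (∫⁻ z, g z ^ p ∂(π : Measure (C.extremePoints ℝ × C.extremePoints ℝ))) ^ (1 / p) ≤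
        R * (a + b) := by
    intro R g hR hgz
    have hmd : Measurable fun z : C.extremePoints ℝ × C.extremePoints ℝ =>
      ENNReal.ofReal (d z.1 z.2) := hc.measurable.ennreal_ofReal
    refine le_trans ?_ (hbound R hR)
    calc (∫⁻ z, g z ^ p ∂(π : Measure (C.extremePoints ℝ × C.extremePoints ℝ))) ^ (1 / p)
        ≤ (∫⁻ z, (R * ENNReal.ofReal (d z.1 z.2) + ε) ^ p
            ∂(π : Measure (C.extremePoints ℝ × C.extremePoints ℝ))) ^ (1 / p) := by
          refine ENNReal.rpow_le_rpow (lintegral_mono fun z => ?_) (by positivity)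
          exact ENNReal.rpow_le_rpow (hgz z) hp0.le
      _ ≤ (∫⁻ z, (R * ENNReal.ofReal (d z.1 z.2)) ^ p
            ∂(π : Measure (C.extremePoints ℝ × C.extremePoints ℝ))) ^ (1 / p) +
          (∫⁻ _, ε ^ p ∂(π : Measure (C.extremePoints ℝ × C.extremePoints ℝ))) ^ (1 / p) :=
          ENNReal.lintegral_Lp_add_le (hmd.const_mul R).aemeasurable aemeasurable_const hp
      _ = R * L₀ + ε := by
          simp_rw [ENNReal.mul_rpow_of_nonneg _ _ hp0.le]
          rw [lintegral_const_mul _ (hmd.pow_const p), lintegral_const, measure_univ, mul_one,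
            ENNReal.mul_rpow_of_nonneg _ _ (by positivity), one_div,
            ENNReal.rpow_rpow_inv hp0.ne', ENNReal.rpow_rpow_inv hp0.ne', hL₀, one_div]
  have hTSr : 1 - T.toReal = S.toReal := by
    have := congrArg ENNReal.toReal hTS
    rw [ENNReal.toReal_add hTt hSt, ENNReal.toReal_one] at this
    linarith
  obtain ⟨M, hM, hMz⟩ := hg.exists_measurable_approx hc (a := T.toReal)
    ⟨ENNReal.toReal_nonneg, by linarith [ENNReal.toReal_nonneg (a := S)]⟩
    (ENNReal.toReal_pos hε0 hεt)
  rw [hTSr] at hMz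
  have hconv : ∀ R : ℝ≥0∞, R ≠ ⊤ → ∀ r s : ℝ, 0 ≤ s → r ≤ R.toReal * s + ε.toReal →
      ENNReal.ofReal r ≤ R * ENNReal.ofReal s + ε := by
    intro R hR r s hs hr
    refine (ENNReal.ofReal_le_ofReal hr).trans ?_
    rw [ENNReal.ofReal_add (by positivity) ENNReal.toReal_nonneg,
      ENNReal.ofReal_mul ENNReal.toReal_nonneg, ENNReal.ofReal_toReal hR,
      ENNReal.ofReal_toReal hεt]
  -- The interpolated measure is the image of the coupling under M; its barycenter is the
  -- intermediate point.
  obtain ⟨z, hz⟩ := exists_mem_representing_of_probabilityMeasure hCc hCx (π.map hM.aemeasurable)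
  have hμπ : μ = π.map measurable_fst.aemeasurable :=
    ProbabilityMeasure.toMeasure_injective (by simpa using hπ.1.symm)
  have hνπ : ν = π.map measurable_snd.aemeasurable :=
    ProbabilityMeasure.toMeasure_injective (by simpa using hπ.2.symm)
  refine ⟨z, (foldedWasserstein_le_wasserstein hμ hz).trans ?_,
    (foldedWasserstein_le_wasserstein hz hν).trans ?_⟩
  · rw [hμπ]
    refine (wasserstein_map_map_le hp0.le hc.measurable π measurable_fst hM).trans
      ((hLp T _ (min_le_left _ _) fun z => ?_).trans_eq hTL)
    exact hconv T hTt _ _ (hd.nonneg _ _) (hMz z).1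
  · rw [hνπ]
    refine (wasserstein_map_map_le hp0.le hc.measurable π hM measurable_snd).trans
      ((hLp S _ (min_le_right _ _) fun z => ?_).trans_eq hSL)
    exact hconv S hSt _ _ (hd.nonneg _ _) (hMz z).2

theorem exists_intermediate_of_foldedWasserstein_lt [CompleteSpace X] (hCc : IsCompact C)
    (hCx : Convex ℝ C) (hp : 1 ≤ p) (hd : IsDistance d)
    (hc : Continuous fun z : C.extremePoints ℝ × C.extremePoints ℝ => d z.1 z.2)
    (hg : IsGeodesic d) {x y : C} {a b : ℝ≥0∞} (ha : a ≠ ⊤) (hb : b ≠ ⊤)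
    (h : foldedWasserstein d p x y < a + b) :
    ∃ z, foldedWasserstein d p x z ≤ a ∧ foldedWasserstein d p z y ≤ b := by
  obtain ⟨N, hN⟩ := iInf_lt_iff.1 h
  obtain ⟨w, hNw⟩ := iInf_lt_iff.1 hN
  obtain ⟨hw, hsum⟩ := iInf_lt_iff.1 hNw
  obtain ⟨-, rfl, rfl⟩ := hw
  -- The splitting a, b must vary in the induction, as the cut may fall on any link of the chain.
  have hk : ∀ (k : ℕ) (a b : ℝ≥0∞), a ≠ ⊤ → b ≠ ⊤ →
      ∑ n ∈ Finset.range k, foldedKantorovich d p (w n) (w (n + 1)) < a + b →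
      ∃ z, foldedWasserstein d p (w 0) z ≤ a ∧ foldedWasserstein d p z (w k) ≤ b := by
    intro k
    induction k with
    | zero =>
      intro a b _ _ _
      have h0 := foldedWasserstein_self hCc hCx (by linarith) hd hc.measurable (w 0)
      exact ⟨w 0, by simp [h0], by simp [h0]⟩
    | succ k ih =>
      intro a b ha hb hlt
      rw [Finset.sum_range_succ] at hlt
      exact exists_intermediate_trans ih (fun a b ha hb hlt =>
        exists_intermediate_of_foldedKantorovich_lt hCc hCx hp hd hc hg ha hb hlt) ha hb hlt
  exact hk N a b ha hb hsum

theorem isGeodesic_foldedDist [CompleteSpace X] (hCc : IsCompact C) (hCx : Convex ℝ C)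
    (hp : 1 ≤ p) (hd : IsDistance d)
    (hc : Continuous fun z : C.extremePoints ℝ × C.extremePoints ℝ => d z.1 z.2)
    (hnorm : ∀ x y : C.extremePoints ℝ, ‖(x : X) - (y : X)‖ ≤ d x y) (hg : IsGeodesic d) :
    IsGeodesic (foldedDist d p) := by
  have : CompactSpace C := isCompact_iff_compactSpace.1 hCc
  refine (isDistance_foldedDist hCc hCx hp hd hc hnorm).isGeodesic_of_approx
    (distTopology_foldedDist hCc hCx hp hd hc hnorm) fun x y L hL a ha => ?_
  -- Splitting L' instead of L turns the non-strict bounds on the two parts into strict ones.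
  obtain ⟨L', hL₁, hL₂⟩ := exists_between hL
  have hL'0 : 0 ≤ L' := ENNReal.toReal_nonneg.trans hL₁.le
  have h1a : 0 < 1 - a := sub_pos.2 ha.2
  have hlt : foldedWasserstein d p x y < ENNReal.ofReal (a * L') +
      ENNReal.ofReal ((1 - a) * L') := by
    rw [← ENNReal.ofReal_add (mul_nonneg ha.1.le hL'0) (mul_nonneg h1a.le hL'0), ← add_mul,
      add_sub_cancel, one_mul]
    exact (ENNReal.lt_ofReal_iff_toReal_lt
      (foldedWasserstein_ne_top hCc hCx (by linarith) hd hc x y)).2 hL₁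
  obtain ⟨z, hz₁, hz₂⟩ := exists_intermediate_of_foldedWasserstein_lt hCc hCx hp hd hc hg
    ENNReal.ofReal_ne_top ENNReal.ofReal_ne_top hlt
  exact ⟨z,
    (ENNReal.toReal_le_of_le_ofReal (mul_nonneg ha.1.le hL'0) hz₁).trans_lt
      (mul_lt_mul_of_pos_left hL₂ ha.1),
    (ENNReal.toReal_le_of_le_ofReal (mul_nonneg h1a.le hL'0) hz₂).trans_lt
      (mul_lt_mul_of_pos_left hL₂ h1a)⟩

end Folded

end FoldedOT

theorem theorem2p12 {X : Type*} [NormedAddCommGroup X] [NormedSpace ℝ X] [CompleteSpace X]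
    [MeasurableSpace X] [BorelSpace X]
    (C : Set X) (hC_nonempty : C.Nonempty) (hC_compact : IsCompact C) (hC_convex : Convex ℝ C)
    (hE_compact : IsCompact (C.extremePoints ℝ))
    (d : C.extremePoints ℝ → C.extremePoints ℝ → ℝ)
    (hd : FoldedOT.IsDistance d)
    (hd_top : FoldedOT.distTopology d = instTopologicalSpaceSubtype)
    (hd_norm : ∀ x y : C.extremePoints ℝ, ‖(x : X) - (y : X)‖ ≤ d x y)
    (p : ℝ) (hp : 1 ≤ p) :
    -- (i) `D_p` is a (finite) distance on `C`, which makes it compact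
    ((∀ x y : C, FoldedOT.foldedWasserstein d p x y ≠ ⊤) ∧
      FoldedOT.IsDistance (FoldedOT.foldedDist d p) ∧
      @CompactSpace C (FoldedOT.distTopology (FoldedOT.foldedDist d p)) ∧
      ((intrinsicInterior ℝ C).Nonempty →
        FoldedOT.distTopology (FoldedOT.foldedDist d p) =
          (instTopologicalSpaceSubtype : TopologicalSpace C))) ∧
    -- (ii) geodesicity
    (FoldedOT.IsGeodesic d → 1 < p → FoldedOT.IsGeodesic (FoldedOT.foldedDist d p)) ∧
    -- (iii) `D_p` upper-bounds the norm distance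
    (∀ x y : C, ‖(x : X) - (y : X)‖ ≤ FoldedOT.foldedDist d p x y) ∧
    -- (iv) `D_p` sub-extends `d`, and extends it when `d` is the norm distance
    ((∀ x y : C.extremePoints ℝ,
        FoldedOT.foldedDist d p (FoldedOT.ofExtreme x) (FoldedOT.ofExtreme y) ≤ d x y) ∧
      ((∀ x y : C.extremePoints ℝ, d x y = ‖(x : X) - (y : X)‖) →
        ∀ x y : C.extremePoints ℝ,
          FoldedOT.foldedDist d p (FoldedOT.ofExtreme x) (FoldedOT.ofExtreme y) = d x y)) := by
  have hp0 : 0 < p := by linarith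
  have : CompactSpace (C.extremePoints ℝ) := isCompact_iff_compactSpace.1 hE_compact
  have : SecondCountableTopology (C.extremePoints ℝ) := EMetric.secondCountable_of_sigmaCompact _
  have hc := hd.continuous hd_top
  have hnorm := FoldedOT.norm_sub_le_foldedDist hC_compact hC_convex hp hd hc hd_norm
  have hext := FoldedOT.foldedDist_ofExtreme_le hp0 hd hc.measurable
  refine ⟨⟨FoldedOT.foldedWasserstein_ne_top hC_compact hC_convex hp0 hd hc,
    FoldedOT.isDistance_foldedDist hC_compact hC_convex hp hd hc hd_norm,
    FoldedOT.compactSpace_foldedDist hC_compact hC_convex hp hd hc,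
    fun _ => FoldedOT.distTopology_foldedDist hC_compact hC_convex hp hd hc hd_norm⟩,
    fun hg _ => FoldedOT.isGeodesic_foldedDist hC_compact hC_convex hp hd hc hd_norm hg,
    hnorm, hext, fun heq x y => le_antisymm (hext x y) ?_⟩
  rw [heq]
  exact hnorm (FoldedOT.ofExtreme x) (FoldedOT.ofExtreme y)
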